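/- Let $E$ be a complex Hilbert space, $\mathbb T$ the unit circle with normalized Lebesgue measure $m$, and let $H^\infty(\mathbb T,\mathcal B(E))$ be the set of functions $\Phi:\mathbb T\to\mathcal B(E)$ such that, for every $x\in E$, $\Phi(\cdot)x\in L^\infty(\mathbb T,E)$ and $\int_{\mathbb T}\overline z^{\,n}\Phi(z)x\,dm(z)=0$ for all integers $n<0$. Two such functions $\Phi,\Psi$ are identified if, for every $x\in E$, $\Phi(z)x=\Psi(z)x$ for almost all $z\in\mathbb T$ (for separable $E$ this means $\Phi=\Psi$ a.e. on $\mathbb T$), and equalities below are understood in this sense. A function $\Delta\in H^\infty(\mathbb T,\mathcal B(E))$ is inner if $\Delta^*\Delta=I_E$ a.e. on $\mathbb T$, in the sense that for all $x,y\in E$, $\langle\Delta(z)^*\Delta(z)x,y\rangle=\langle x,y\rangle$ for almost all $z\in\mathbb T$ (for separable $E$ this is the pointwise a.e. equality). An inner function $\Delta$ is an inner divisor of $\Theta$ if $\Theta=\Delta A=B\Delta$ for some $A,B\in H^\infty(\mathbb T,\mathcal B(E))$. For $|\alpha|<1$ put $b_\alpha(z)=\dfrac{z-\alpha}{1-\overline\alpha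 z}$. Let $\theta=\nu\prod_{n=1}^{N}b_{\alpha_n}$ be a finite Blaschke product, where $|\nu|=1$, $N\ge 0$ and $|\alpha_n|<1$ for each $n$. If $\Delta\in H^\infty(\mathbb T,\mathcal B(E))$ is an inner divisor of $\theta I_E$, then $\Delta$ is a finite Blaschke–Potapov product; that is, $$\Delta=V\prod_{m=1}^{M}\bigl(b_{\beta_m}P_m+(I_E-P_m)\bigr)$$ for some unitary operator $V\in\mathcal B(E)$, some $M\ge 0$, points $\beta_1,\dots,\beta_M$ of the open unit disc, and orthogonal projections $P_1,\dots,P_M$ in $E$, the factors being multiplied from left to right in the order of their indices. -/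

import Mathlib

open MeasureTheory AddCircle
open scoped ENNReal ComplexConjugate InnerProductSpace

/-! The unit circle `𝕋` is parametrised by `t : UnitAddCircle = ℝ/ℤ` through
`t ↦ z = e^{2πit}` (`AddCircle.toCircle`); the normalized Lebesgue measure on it is
`haarAddCircle`, and `fourierCoeff f n = ∫ z^{-n} f dm` as a Bochner integral. -/

section Hardy

variable {D D' E : Type*}
  [NormedAddCommGroup D] [InnerProductSpace ℂ D] [CompleteSpace D]
  [NormedAddCommGroup D'] [InnerProductSpace ℂ D'] [CompleteSpace D']
  [NormedAddCommGroup E] [InnerProductSpace ℂ E] [CompleteSpace E]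

/-- `Φ ∈ H^∞(𝕋, B(D,E))`: for every `x` the function `Φ(·)x` is in `L^∞(𝕋, E)`
(which includes strong measurability), and `Φ̂(n)x = (Φ(·)x)^(n) = 0` for all `n < 0`. -/
def MemHInf (Φ : UnitAddCircle → (D →L[ℂ] E)) : Prop :=
  (∀ x : D, MemLp (fun t => Φ t x) ∞ haarAddCircle) ∧
    ∀ n : ℤ, n < 0 → ∀ x : D, fourierCoeff (fun t => Φ t x) n = 0

/-- Equality of `Φ` and `Ψ` as strong `L^p`-functions: for every `x`, the functions `Φ(·)x` and
`Ψ(·)x` are the same element of `L^p(𝕋, E)`. When `D` is separable, this says that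
`Φ = Ψ` a.e. on `𝕋`. -/
def StrongAEEq (Φ Ψ : UnitAddCircle → (D →L[ℂ] E)) : Prop :=
  ∀ x : D, ∀ᵐ t ∂(haarAddCircle : Measure UnitAddCircle), Φ t x = Ψ t x

/-- `Δ ∈ H^∞(𝕋, B(D,E))` is inner: `Δ^*Δ = I_D` a.e. on `𝕋`. The equality is tested
against pairs of vectors, so that it depends only on the class of `Δ` under `StrongAEEq`;
when `D` is separable, it says that `Δ(z)^*Δ(z) = I_D` for almost all `z`. -/
def IsInnerFun (Δ : UnitAddCircle → (D →L[ℂ] E)) : Prop :=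
  MemHInf Δ ∧
    ∀ x y : D, ∀ᵐ t ∂(haarAddCircle : Measure UnitAddCircle),
      ⟪(ContinuousLinearMap.adjoint (Δ t) ∘L Δ t) x, y⟫_ℂ = ⟪x, y⟫_ℂ

/-- The inner function `Δ` is a left inner divisor of `Φ`: `Φ = Δ A` for some `A` in `H^∞`. -/
def IsLeftInnerDivisor (Δ : UnitAddCircle → (D' →L[ℂ] E))
    (Φ : UnitAddCircle → (D →L[ℂ] E)) : Prop :=
  IsInnerFun Δ ∧ ∃ A : UnitAddCircle → (D →L[ℂ] D'),
    MemHInf A ∧ StrongAEEq Φ (fun t => Δ t ∘L A t)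

/-- The inner function `Ω` is a right inner divisor of `Φ`: `Φ = B Ω` for some `B` in `H^∞`. -/
def IsRightInnerDivisor (Ω : UnitAddCircle → (D →L[ℂ] D'))
    (Φ : UnitAddCircle → (D →L[ℂ] E)) : Prop :=
  IsInnerFun Ω ∧ ∃ B : UnitAddCircle → (D' →L[ℂ] E),
    MemHInf B ∧ StrongAEEq Φ (fun t => B t ∘L Ω t)

/-- An inner divisor is both a left and a right inner divisor. -/
def IsInnerDivisor (Δ Φ : UnitAddCircle → (D →L[ℂ] E)) : Prop :=
  IsLeftInnerDivisor Δ Φ ∧ IsRightInnerDivisor Δ Φ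

end Hardy

section Blaschke

/-- The Blaschke factor `b_α(z) = (z - α) / (1 - \bar α z)` at the point `z = e^{2πit}`. -/
noncomputable def blaschkeFactor (α : ℂ) (t : UnitAddCircle) : ℂ :=
  ((toCircle t : ℂ) - α) / (1 - conj α * (toCircle t : ℂ))

/-- `θ = ν ∏ b_{α_m}` on `𝕋`, with `|ν| = 1` and finitely many `α_m` in the open unit disc. -/
def IsFiniteBlaschkeProduct (θ : UnitAddCircle → ℂ) : Prop :=
  ∃ (ν : ℂ) (M : ℕ) (α : Fin M → ℂ), ‖ν‖ = 1 ∧ (∀ m, ‖α m‖ < 1) ∧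
    ∀ t, θ t = ν * ∏ m, blaschkeFactor (α m) t

variable {E : Type*} [NormedAddCommGroup E] [InnerProductSpace ℂ E] [CompleteSpace E]

/-- The Blaschke–Potapov factor `b_α P + (I - P)`. -/
noncomputable def blaschkePotapovFactor (α : ℂ) (P : E →L[ℂ] E) (t : UnitAddCircle) : E →L[ℂ] E :=
  blaschkeFactor α t • P + (1 - P)

/-- `Δ = V ∏_{m=1}^M (b_{α_m} P_m + (I - P_m))` as an element of `H^∞(𝕋, B(E))`, with `V` unitary,
`|α_m| < 1` and `P_m` orthogonal projections; the factors are multiplied from left to right in the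
order of their indices. -/
def IsFiniteBlaschkePotapovProduct (Δ : UnitAddCircle → (E →L[ℂ] E)) : Prop :=
  ∃ (V : E →L[ℂ] E) (M : ℕ) (α : Fin M → ℂ) (P : Fin M → (E →L[ℂ] E)),
    V ∈ unitary (E →L[ℂ] E) ∧ (∀ m, ‖α m‖ < 1) ∧ (∀ m, IsStarProjection (P m)) ∧
    StrongAEEq Δ
      (fun t => V * (List.ofFn fun m => blaschkePotapovFactor (α m) (P m) t).prod)

end Blaschke

/-! A degree-one factor is split off for each zero of `θ`; only the identity `θ I = Δ A` with `A`
analytic is used.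

Let `α` be a zero of `θ = θ' b_α`. The vectors `x` for which `Δ x` is divisible by `b_α` in `H^∞`
form a closed subspace `K`, the kernel of the value `Δ(α)`; let `P` be the projection onto `K`. Then
`Δ = Δ' (b_α P + (I - P))` with `Δ' = b_α⁻¹ Δ P + Δ (I - P)` again inner. From
`Δ(α) A(α) = θ(α) I = 0` the range of `A(α)` lies in `K`, so `(I - P) A` vanishes at `α` and
`A' = P A + b_α⁻¹ (I - P) A` is analytic, while `Δ' A' = b_α⁻¹ Δ A = θ' I`
(`IsInnerFun.exists_factor`). After all zeros are removed, `Δ A = ν I` with `|ν| = 1`. Then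
`A = ν Δ^*` has only nonnegative frequencies and `Δ^*` only nonpositive ones, so `Δ` is constant,
and it is unitary (`IsInnerFun.exists_unitary_of_mul_eq_const`).

Values inside the disc are never formed: "`f - a` is divisible by `b_α` for some vector `a`"
(`exists_memVectorHInf_conj_blaschkeFactor_smul_sub`) is derived from recursions between Fourier
coefficients. That `Δ g` is analytic for analytic `g` (`fourierCoeff_clm_apply_eq_zero`) follows
by approximating `g` in `L²` by analytic trigonometric polynomials, since `Δ` acts isometrically.
As `E` need not be separable, identities holding almost everywhere for each constant vector are
transferred to strongly measurable functions through their almost separable range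
(`ae_inner_clm_apply_eq`, `ae_norm_clm_apply_eq`). -/

/-! ### Vector-valued Fourier series -/

section FourierSeries

variable {E : Type*} [NormedAddCommGroup E] [InnerProductSpace ℂ E]

theorem memLp_fourier_smul_const (n : ℤ) (c : E) (p : ℝ≥0∞) :
    MemLp (fun t : UnitAddCircle => fourier n t • c) p haarAddCircle := by
  have : MemLp (fun t : UnitAddCircle => fourier n t • c) ∞ haarAddCircle := by
    refine memLp_top_of_bound ?_ ‖c‖ (ae_of_all _ fun t => ?_)
    · exact ((map_continuous (fourier n)).smul continuous_const).aestronglyMeasurable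
    · rw [norm_smul, fourier_apply, Circle.norm_coe, one_mul]
  exact this.mono_exponent le_top

theorem fourierCoeff_fourier_smul (f : UnitAddCircle → E) (k n : ℤ) :
    fourierCoeff (fun t => fourier k t • f t) n = fourierCoeff f (n - k) := by
  unfold fourierCoeff
  congr 1
  ext t
  rw [smul_smul, ← fourier_add]
  congr 2
  ring_nf

theorem fourierCoeff_sub {f g : UnitAddCircle → E} (hf : Integrable f haarAddCircle)
    (hg : Integrable g haarAddCircle) (n : ℤ) :
    fourierCoeff (fun t => f t - g t) n = fourierCoeff f n - fourierCoeff g n := by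
  simp only [fourierCoeff, smul_sub]
  exact integral_sub (hf.fourier_smul _) (hg.fourier_smul _)

theorem norm_fourierCoeff_le (f : UnitAddCircle → E) (n : ℤ) :
    ‖fourierCoeff f n‖ ≤ ∫ t, ‖f t‖ ∂haarAddCircle := by
  refine (norm_integral_le_integral_norm _).trans_eq ?_
  simp only [norm_smul, fourier_apply, Circle.norm_coe, one_mul]

variable [CompleteSpace E]

theorem fourierCoeff_inner {f : UnitAddCircle → E} (hf : Integrable f haarAddCircle) (c : E)
    (n : ℤ) : fourierCoeff (fun t => ⟪c, f t⟫_ℂ) n = ⟪c, fourierCoeff f n⟫_ℂ := by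
  rw [fourierCoeff, fourierCoeff, ← integral_inner (hf.fourier_smul _)]
  simp only [inner_smul_right, smul_eq_mul]

theorem ae_eq_zero_of_forall_ae_inner_eq_zero {f : UnitAddCircle → E}
    (hf : Integrable f haarAddCircle)
    (h : ∀ c : E, ∀ᵐ t ∂(haarAddCircle : Measure UnitAddCircle), ⟪c, f t⟫_ℂ = 0) :
    f =ᵐ[haarAddCircle] 0 := by
  refine hf.ae_eq_zero_of_forall_setIntegral_eq_zero fun s _ _ => ?_
  refine ext_inner_left ℂ fun c => ?_
  rw [← integral_inner hf.integrableOn, inner_zero_right]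
  exact integral_eq_zero_of_ae (ae_restrict_of_ae (h c))

/-- A square-integrable function on the circle with vanishing Fourier coefficients is zero. No
separability is needed, since an integrable function is almost separably valued. -/
theorem ae_eq_zero_of_fourierCoeff_eq_zero {f : UnitAddCircle → E} (hf : MemLp f 2 haarAddCircle)
    (h : ∀ n, fourierCoeff f n = 0) : f =ᵐ[haarAddCircle] 0 := by
  have hi : Integrable f haarAddCircle := hf.integrable one_le_two
  refine ae_eq_zero_of_forall_ae_inner_eq_zero hi fun c => ?_
  have hc : MemLp (fun t => ⟪c, f t⟫_ℂ) 2 haarAddCircle := hf.const_inner c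
  have h0 : hc.toLp _ = 0 := by
    apply (fourierBasis (T := 1)).repr.injective
    ext n
    rw [fourierBasis_repr, fourierCoeff_congr_ae hc.coeFn_toLp, fourierCoeff_inner hi, h]
    simp
  filter_upwards [hc.coeFn_toLp, Lp.coeFn_zero ℂ 2 (haarAddCircle : Measure UnitAddCircle)]
    with t h1 h2
  rw [← h1, h0, h2]
  rfl

/-- The vector-valued monomial `z ^ n • c` as an element of `L²(𝕋, E)`. -/
noncomputable def fourierSmulLp (n : ℤ) (c : E) : Lp E 2 (haarAddCircle : Measure UnitAddCircle) :=
  (memLp_fourier_smul_const n c 2).toLp _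

theorem inner_fourierSmulLp (n : ℤ) (c : E) (f : Lp E 2 (haarAddCircle : Measure UnitAddCircle)) :
    ⟪fourierSmulLp n c, f⟫_ℂ = ⟪c, fourierCoeff f n⟫_ℂ := by
  rw [L2.inner_def, ← fourierCoeff_inner ((Lp.memLp f).integrable one_le_two), fourierCoeff]
  refine integral_congr_ae ?_
  filter_upwards [(memLp_fourier_smul_const n c 2).coeFn_toLp] with t ht
  rw [fourierSmulLp, ht, inner_smul_left, fourier_neg, smul_eq_mul]

theorem fourierCoeff_const (c : E) {n : ℤ} (hn : n ≠ 0) :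
    fourierCoeff (fun _ : UnitAddCircle => c) n = 0 := by
  have h : ∫ t : UnitAddCircle, fourier (-n) t ∂haarAddCircle = 0 :=
    integral_eq_zero_of_add_right_eq_neg (fourier_add_half_inv_index (neg_ne_zero.mpr hn) one_pos)
  rw [fourierCoeff, integral_smul_const, h, zero_smul]

theorem fourierCoeff_const_zero (c : E) :
    fourierCoeff (fun _ : UnitAddCircle => c) 0 = c := by
  simp [fourierCoeff]

/-- An `L²`-function with nonnegative spectrum lies in the closed span of the analytic vector
monomials. -/
theorem mem_closure_span_of_fourierCoeff_neg_eq_zero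
    (f : Lp E 2 (haarAddCircle : Measure UnitAddCircle))
    (hf : ∀ n < 0, fourierCoeff f n = 0) :
    f ∈ (Submodule.span ℂ {g | ∃ n : ℤ, 0 ≤ n ∧ ∃ c : E, g = fourierSmulLp n c}).topologicalClosure
    := by
  set S := Submodule.span ℂ {g : Lp E 2 (haarAddCircle : Measure UnitAddCircle) |
    ∃ n : ℤ, 0 ≤ n ∧ ∃ c : E, g = fourierSmulLp n c} with hS
  set p := S.topologicalClosure.starProjection f with hp
  have hpS : p ∈ S.topologicalClosure := Submodule.starProjection_apply_mem _ _
  have hq : f - p ∈ Sᗮ := by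
    rw [← Submodule.orthogonal_closure]
    exact Submodule.sub_starProjection_mem_orthogonal f
  -- The residual `f - p` has no frequencies at all: the nonnegative ones are removed by the
  -- projection, and neither `f` nor `p` has negative ones.
  have hneg : ∀ n < 0, ∀ c : E, ⟪fourierSmulLp n c, p⟫_ℂ = 0 := by
    intro n hn c
    have hmem : fourierSmulLp n c ∈ Sᗮ := by
      have hle : S ≤ (Submodule.span ℂ {fourierSmulLp n c})ᗮ := by
        rw [hS, Submodule.span_le]
        rintro _ ⟨k, hk, d, rfl⟩
        rw [SetLike.mem_coe, Submodule.mem_orthogonal_singleton_iff_inner_left, inner_fourierSmulLp,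
          fourierSmulLp, fourierCoeff_congr_ae (memLp_fourier_smul_const n c 2).coeFn_toLp,
          fourierCoeff_fourier_smul, fourierCoeff_const _ (by omega), inner_zero_right]
      exact Submodule.orthogonal_le hle
        (Submodule.le_orthogonal_orthogonal _ (Submodule.mem_span_singleton_self _))
    rw [← Submodule.orthogonal_closure] at hmem
    exact (Submodule.mem_orthogonal' _ _).mp hmem p hpS
  have hcoef : ∀ n, fourierCoeff (f - p : Lp E 2 (haarAddCircle : Measure UnitAddCircle)) n = 0 := by
    intro n
    refine ext_inner_left ℂ fun c => ?_
    rw [← inner_fourierSmulLp, inner_zero_right]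
    rcases lt_or_ge n 0 with hn | hn
    · rw [inner_sub_right, hneg n hn c, inner_fourierSmulLp, hf n hn, inner_zero_right, sub_zero]
    · exact (Submodule.mem_orthogonal _ _).mp hq _ (Submodule.subset_span ⟨n, hn, c, rfl⟩)
  have h0 : f - p = 0 :=
    Lp.eq_zero_iff_ae_eq_zero.mpr (ae_eq_zero_of_fourierCoeff_eq_zero (Lp.memLp _) hcoef)
  rw [sub_eq_zero.mp h0]
  exact hpS

end FourierSeries

/-! ### Multiplication by strongly measurable isometric families -/

section IsometricMultiplication

variable {α E F : Type*} [MeasurableSpace α] {μ : Measure α}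
  [NormedAddCommGroup E] [InnerProductSpace ℂ E]
  [NormedAddCommGroup F] [InnerProductSpace ℂ F]

/-- A strongly measurable family of operators maps strongly measurable functions to strongly
measurable functions. -/
theorem aestronglyMeasurable_clm_apply {Φ : α → E →L[ℂ] F}
    (hΦ : ∀ x, AEStronglyMeasurable (fun t => Φ t x) μ) {g : α → E}
    (hg : AEStronglyMeasurable g μ) : AEStronglyMeasurable (fun t => Φ t (g t)) μ := by
  have hsimple : ∀ s : SimpleFunc α E, AEStronglyMeasurable (fun t => Φ t (s t)) μ := by
    intro s
    induction s using SimpleFunc.induction with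
    | const c hs =>
      rename_i A
      have : (fun t => Φ t ((SimpleFunc.piecewise A hs (SimpleFunc.const α c)
          (SimpleFunc.const α 0)) t)) = A.indicator (fun t => Φ t c) := by
        ext t
        by_cases ht : t ∈ A <;> simp [ht]
      rw [this]
      exact (hΦ c).indicator hs
    | add _ hf hg =>
      simp only [SimpleFunc.coe_add, Pi.add_apply, map_add]
      exact hf.add hg
  have hlim : AEStronglyMeasurable (fun t => Φ t (hg.mk g t)) μ := by
    refine aestronglyMeasurable_of_tendsto_ae Filter.atTop
      (fun n => hsimple (hg.stronglyMeasurable_mk.approx n)) (ae_of_all _ fun t => ?_)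
    exact ((Φ t).continuous.tendsto _).comp (hg.stronglyMeasurable_mk.tendsto_approx t)
  refine hlim.congr ?_
  filter_upwards [hg.ae_eq_mk] with t ht
  rw [← ht]

/-- If `Φ` preserves each inner product of constant vectors almost everywhere, it preserves inner
products with strongly measurable functions: these are almost separably valued, so countably many
constant vectors suffice. -/
theorem ae_inner_clm_apply_eq {Φ : α → E →L[ℂ] F}
    (hΦ : ∀ x y, ∀ᵐ t ∂μ, ⟪Φ t x, Φ t y⟫_ℂ = ⟪x, y⟫_ℂ) {g : α → E}
    (hg : AEStronglyMeasurable g μ) (x : E) :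
    ∀ᵐ t ∂μ, ⟪Φ t x, Φ t (g t)⟫_ℂ = ⟪x, g t⟫_ℂ := by
  obtain ⟨S, ⟨C, hC, hSC⟩, hS⟩ := hg.isSeparable_ae_range
  have h := (ae_ball_iff hC).mpr fun d _ => hΦ x d
  filter_upwards [h, hS] with t ht hgt
  have hcl : IsClosed {y | ⟪Φ t x, Φ t y⟫_ℂ = ⟪x, y⟫_ℂ} :=
    isClosed_eq (by fun_prop) (by fun_prop)
  exact hcl.closure_subset_iff.mpr ht (hSC hgt)

theorem ae_norm_clm_apply_eq {Φ : α → E →L[ℂ] F}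
    (hΦ : ∀ x, ∀ᵐ t ∂μ, ‖Φ t x‖ = ‖x‖) {g : α → E}
    (hg : AEStronglyMeasurable g μ) : ∀ᵐ t ∂μ, ‖Φ t (g t)‖ = ‖g t‖ := by
  obtain ⟨S, ⟨C, hC, hSC⟩, hS⟩ := hg.isSeparable_ae_range
  have h := (ae_ball_iff hC).mpr fun d _ => hΦ d
  filter_upwards [h, hS] with t ht hgt
  have hcl : IsClosed {y | ‖Φ t y‖ = ‖y‖} := isClosed_eq (by fun_prop) (by fun_prop)
  exact hcl.closure_subset_iff.mpr ht (hSC hgt)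

end IsometricMultiplication

/-! ### Analytic multiplication operators -/

section AnalyticMultiplication

variable {E : Type*} [NormedAddCommGroup E] [InnerProductSpace ℂ E] [CompleteSpace E]

/-- An isometric analytic family of operators maps analytic functions to analytic functions: the
`n`-th coefficient of `Φ g` depends continuously on `g ∈ L²`, and for negative `n` it vanishes on
analytic monomials. -/
theorem fourierCoeff_clm_apply_eq_zero {Φ : UnitAddCircle → E →L[ℂ] E}
    (hΦm : ∀ x, AEStronglyMeasurable (fun t => Φ t x) haarAddCircle)
    (hΦi : ∀ x, ∀ᵐ t ∂(haarAddCircle : Measure UnitAddCircle), ‖Φ t x‖ = ‖x‖)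
    (hΦa : ∀ n < 0, ∀ x, fourierCoeff (fun t => Φ t x) n = 0)
    {g : UnitAddCircle → E} (hg : MemLp g 2 haarAddCircle)
    (hga : ∀ n < 0, fourierCoeff g n = 0) {n : ℤ} (hn : n < 0) :
    fourierCoeff (fun t => Φ t (g t)) n = 0 := by
  have hint : ∀ f : Lp E 2 (haarAddCircle : Measure UnitAddCircle),
      Integrable (fun t => Φ t (f t)) haarAddCircle := fun f =>
    ((Lp.memLp f).integrable one_le_two).congr' (aestronglyMeasurable_clm_apply hΦm
      (Lp.aestronglyMeasurable f))
      ((ae_norm_clm_apply_eq hΦi (Lp.aestronglyMeasurable f)).mono fun _ h => h.symm)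
  let L : Lp E 2 (haarAddCircle : Measure UnitAddCircle) →ₗ[ℂ] E :=
    { toFun := fun f => fourierCoeff (fun t => Φ t (f t)) n
      map_add' := fun f h => by
        rw [← Pi.add_apply, ← fourierCoeff.add (hint f) (hint h)]
        refine congrFun (fourierCoeff_congr_ae ?_) n
        filter_upwards [Lp.coeFn_add f h] with t ht
        simp only [ht, Pi.add_apply, map_add]
      map_smul' := fun c f => by
        rw [RingHom.id_apply, ← fourierCoeff.const_smul]
        refine congrFun (fourierCoeff_congr_ae ?_) n
        filter_upwards [Lp.coeFn_smul c f] with t ht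
        simp only [ht, Pi.smul_apply, map_smul] }
  have hL : ∀ f, ‖L f‖ ≤ 1 * ‖f‖ := by
    intro f
    calc ‖L f‖ ≤ ∫ t, ‖Φ t (f t)‖ ∂haarAddCircle := norm_fourierCoeff_le _ _
      _ = ∫ t, ‖f t‖ ∂haarAddCircle :=
        integral_congr_ae (ae_norm_clm_apply_eq hΦi (Lp.aestronglyMeasurable f))
      _ = (eLpNorm f 1 haarAddCircle).toReal := by
        rw [eLpNorm_one_eq_lintegral_enorm,
          integral_norm_eq_lintegral_enorm (Lp.aestronglyMeasurable f)]
      _ ≤ (eLpNorm f 2 haarAddCircle).toReal :=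
        ENNReal.toReal_mono (Lp.eLpNorm_ne_top f)
          (eLpNorm_le_eLpNorm_of_exponent_le one_le_two (Lp.aestronglyMeasurable f))
      _ = 1 * ‖f‖ := by rw [one_mul, Lp.norm_def]
  let T := L.mkContinuous 1 hL
  have hker : (Submodule.span ℂ {g : Lp E 2 (haarAddCircle : Measure UnitAddCircle) |
      ∃ n : ℤ, 0 ≤ n ∧ ∃ c : E, g = fourierSmulLp n c}).topologicalClosure ≤
      LinearMap.ker (T : Lp E 2 (haarAddCircle : Measure UnitAddCircle) →ₗ[ℂ] E) := by
    refine Submodule.topologicalClosure_minimal _ ?_ T.isClosed_ker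
    rw [Submodule.span_le]
    rintro _ ⟨k, hk, c, rfl⟩
    change fourierCoeff (fun t => Φ t (fourierSmulLp k c t)) n = 0
    rw [← hΦa (n - k) (by omega) c, ← fourierCoeff_fourier_smul]
    refine congrFun (fourierCoeff_congr_ae ?_) n
    filter_upwards [(memLp_fourier_smul_const k c 2).coeFn_toLp] with t ht
    rw [fourierSmulLp, ht, map_smul]
  have hmem : hg.toLp g ∈ LinearMap.ker
      (T : Lp E 2 (haarAddCircle : Measure UnitAddCircle) →ₗ[ℂ] E) := by
    refine hker (mem_closure_span_of_fourierCoeff_neg_eq_zero _ fun m hm => ?_)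
    rw [fourierCoeff_congr_ae hg.coeFn_toLp, hga m hm]
  have hT : fourierCoeff (fun t => Φ t (hg.toLp g t)) n = 0 := hmem
  rw [← hT]
  refine congrFun (fourierCoeff_congr_ae ?_) n
  filter_upwards [hg.coeFn_toLp] with t ht
  rw [ht]

end AnalyticMultiplication

/-! ### Blaschke factors on the circle -/

section BlaschkeFactor

variable {α : ℂ}

theorem toCircle_sub_ne_zero (hα : ‖α‖ < 1) (t : UnitAddCircle) :
    (toCircle t : ℂ) - α ≠ 0 := by
  intro h
  rw [← sub_eq_zero.mp h, Circle.norm_coe] at hα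
  exact lt_irrefl _ hα

theorem one_sub_conj_mul_toCircle (t : UnitAddCircle) :
    1 - conj α * (toCircle t : ℂ) = toCircle t * conj ((toCircle t : ℂ) - α) := by
  have h : (toCircle t : ℂ) * conj (toCircle t : ℂ) = 1 := by
    rw [Complex.mul_conj, Circle.normSq_coe, Complex.ofReal_one]
  rw [map_sub, mul_sub, h]
  ring

theorem one_sub_conj_mul_ne_zero (hα : ‖α‖ < 1) (t : UnitAddCircle) :
    1 - conj α * (toCircle t : ℂ) ≠ 0 := by
  rw [one_sub_conj_mul_toCircle]
  exact mul_ne_zero (Circle.coe_ne_zero _)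
    ((map_ne_zero _).mpr (toCircle_sub_ne_zero hα t))

theorem norm_blaschkeFactor (hα : ‖α‖ < 1) (t : UnitAddCircle) : ‖blaschkeFactor α t‖ = 1 := by
  rw [blaschkeFactor, one_sub_conj_mul_toCircle, norm_div, norm_mul, Circle.norm_coe, one_mul,
    Complex.norm_conj, div_self (norm_ne_zero_iff.mpr (toCircle_sub_ne_zero hα t))]

theorem conj_mul_blaschkeFactor (hα : ‖α‖ < 1) (t : UnitAddCircle) :
    conj (blaschkeFactor α t) * blaschkeFactor α t = 1 := by
  rw [mul_comm, Complex.mul_conj, Complex.normSq_eq_norm_sq, norm_blaschkeFactor hα]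
  norm_num

theorem conj_blaschkeFactor (hα : ‖α‖ < 1) (t : UnitAddCircle) :
    conj (blaschkeFactor α t) = (1 - conj α * (toCircle t : ℂ)) / ((toCircle t : ℂ) - α) := by
  rw [eq_inv_of_mul_eq_one_left (conj_mul_blaschkeFactor hα t), blaschkeFactor, inv_div]

theorem continuous_toCircle_coe : Continuous fun t : UnitAddCircle => (toCircle t : ℂ) :=
  continuous_induced_dom.comp continuous_toCircle

theorem continuous_blaschkeFactor (hα : ‖α‖ < 1) : Continuous (blaschkeFactor α) := by
  unfold blaschkeFactor
  exact (continuous_toCircle_coe.sub continuous_const).div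
    (continuous_const.sub (continuous_const.mul continuous_toCircle_coe))
    (one_sub_conj_mul_ne_zero hα)

theorem continuous_conj_blaschkeFactor (hα : ‖α‖ < 1) :
    Continuous fun t => conj (blaschkeFactor α t) :=
  Complex.continuous_conj.comp (continuous_blaschkeFactor hα)

end BlaschkeFactor

/-! ### The vector-valued Hardy space -/

section HardySpace

variable {E : Type*} [NormedAddCommGroup E]

theorem integrable_of_memLp_top {f : UnitAddCircle → E} (hf : MemLp f ∞ haarAddCircle) :
    Integrable f haarAddCircle :=
  hf.integrable le_top

variable [InnerProductSpace ℂ E]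

/-- `f ∈ H^∞(𝕋, E)`: an essentially bounded vector function whose Fourier coefficients of negative
index vanish. -/
def MemVectorHInf (f : UnitAddCircle → E) : Prop :=
  MemLp f ∞ haarAddCircle ∧ ∀ n < 0, fourierCoeff f n = 0

theorem memLp_top_continuous_smul {c : UnitAddCircle → ℂ} (hc : Continuous c)
    {f : UnitAddCircle → E} (hf : MemLp f ∞ haarAddCircle) :
    MemLp (fun t => c t • f t) ∞ haarAddCircle :=
  hf.smul (hc.memLp_top_of_hasCompactSupport (HasCompactSupport.of_compactSpace c) haarAddCircle)

theorem fourierCoeff_add_apply {f g : UnitAddCircle → E} (hf : MemLp f ∞ haarAddCircle)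
    (hg : MemLp g ∞ haarAddCircle) (n : ℤ) :
    fourierCoeff (fun t => f t + g t) n = fourierCoeff f n + fourierCoeff g n :=
  congrFun (fourierCoeff.add (integrable_of_memLp_top hf) (integrable_of_memLp_top hg)) n

theorem fourierCoeff_toCircle_smul (f : UnitAddCircle → E) (n : ℤ) :
    fourierCoeff (fun t => (toCircle t : ℂ) • f t) n = fourierCoeff f (n - 1) := by
  simpa only [fourier_one] using fourierCoeff_fourier_smul f 1 n

/-- A vector divisible by every power of `a`, with bounded quotients, vanishes when `‖a‖ < 1`. -/
theorem eq_zero_of_forall_eq_pow_smul {a : ℂ} (ha : ‖a‖ < 1) {x : E} {y : ℕ → E} {C : ℝ}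
    (hy : ∀ k, ‖y k‖ ≤ C) (h : ∀ k, x = a ^ k • y k) : x = 0 := by
  have hlim : Filter.Tendsto (fun k : ℕ => ‖a‖ ^ k * C) Filter.atTop (nhds 0) := by
    simpa using (tendsto_pow_atTop_nhds_zero_of_lt_one (norm_nonneg a) ha).mul_const C
  refine norm_le_zero_iff.mp (ge_of_tendsto' hlim fun k => ?_)
  calc ‖x‖ = ‖a‖ ^ k * ‖y k‖ := by rw [← norm_pow, ← norm_smul, ← h k]
    _ ≤ ‖a‖ ^ k * C := by gcongr; exact hy k

namespace MemVectorHInf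

theorem congr {f g : UnitAddCircle → E} (hf : MemVectorHInf f) (h : f =ᵐ[haarAddCircle] g) :
    MemVectorHInf g :=
  ⟨(memLp_congr_ae h).mp hf.1, fun n hn => by rw [← fourierCoeff_congr_ae h, hf.2 n hn]⟩

theorem add {f g : UnitAddCircle → E} (hf : MemVectorHInf f) (hg : MemVectorHInf g) :
    MemVectorHInf fun t => f t + g t :=
  ⟨hf.1.add hg.1, fun n hn => by
    rw [fourierCoeff_add_apply hf.1 hg.1, hf.2 n hn, hg.2 n hn, add_zero]⟩

theorem const_smul {f : UnitAddCircle → E} (hf : MemVectorHInf f) (c : ℂ) :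
    MemVectorHInf fun t => c • f t :=
  ⟨hf.1.const_smul c, fun n hn => by
    have := fourierCoeff.const_smul f c n
    rw [hf.2 n hn, smul_zero] at this
    exact this⟩

theorem sub {f g : UnitAddCircle → E} (hf : MemVectorHInf f) (hg : MemVectorHInf g) :
    MemVectorHInf fun t => f t - g t :=
  ⟨hf.1.sub hg.1, fun n hn => by
    rw [fourierCoeff_sub (integrable_of_memLp_top hf.1) (integrable_of_memLp_top hg.1), hf.2 n hn,
      hg.2 n hn, sub_zero]⟩

theorem toCircle_smul {f : UnitAddCircle → E} (hf : MemVectorHInf f) :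
    MemVectorHInf fun t => (toCircle t : ℂ) • f t :=
  ⟨memLp_top_continuous_smul continuous_toCircle_coe hf.1, fun n hn => by
    rw [fourierCoeff_toCircle_smul, hf.2 _ (by omega)]⟩

/-- Multiplication by `1 / (1 - a z)`, `|a| < 1`, preserves `H^∞`: the coefficients `h_n` of the
quotient satisfy `h_n = a h_{n-1}` for `n < 0`, hence `h_n = a ^ k h_{n-k}`, and they are bounded. -/
theorem inv_one_sub_smul {f : UnitAddCircle → E} (hf : MemVectorHInf f) {a : ℂ} (ha : ‖a‖ < 1)
    (hne : ∀ t : UnitAddCircle, 1 - a * (toCircle t : ℂ) ≠ 0) :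
    MemVectorHInf fun t => (1 - a * (toCircle t : ℂ))⁻¹ • f t := by
  set h : UnitAddCircle → E := fun t => (1 - a * (toCircle t : ℂ))⁻¹ • f t with hh
  have hL : MemLp h ∞ haarAddCircle :=
    memLp_top_continuous_smul
      ((continuous_const.sub (continuous_const.mul continuous_toCircle_coe)).inv₀ hne) hf.1
  refine ⟨hL, ?_⟩
  have hrec : ∀ n < 0, fourierCoeff h n = a • fourierCoeff h (n - 1) := by
    intro n hn
    have heq : f = fun t => h t - (a • fun t => (toCircle t : ℂ) • h t) t := by
      ext t
      simp only [hh, Pi.smul_apply]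
      rw [smul_smul, smul_smul, ← sub_smul, ← one_sub_mul, mul_inv_cancel₀ (hne t), one_smul]
    have hz := memLp_top_continuous_smul continuous_toCircle_coe hL
    have h0 := hf.2 n hn
    rw [heq, fourierCoeff_sub (integrable_of_memLp_top hL)
      (integrable_of_memLp_top (hz.const_smul a)), fourierCoeff.const_smul,
      fourierCoeff_toCircle_smul, sub_eq_zero] at h0
    exact h0
  intro n hn
  refine eq_zero_of_forall_eq_pow_smul ha (y := fun k : ℕ => fourierCoeff h (n - k))
    (fun k => norm_fourierCoeff_le h _) fun k => ?_
  induction k with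
  | zero => simp
  | succ k ih =>
    rw [ih, hrec _ (by omega), smul_smul, ← pow_succ]
    push_cast
    rw [sub_add_eq_sub_sub]

theorem blaschkeFactor_smul {f : UnitAddCircle → E} (hf : MemVectorHInf f) {α : ℂ}
    (hα : ‖α‖ < 1) : MemVectorHInf fun t => blaschkeFactor α t • f t := by
  have h := (hf.inv_one_sub_smul (a := conj α) (by rwa [Complex.norm_conj])
    (one_sub_conj_mul_ne_zero hα))
  refine (h.toCircle_smul.sub (h.const_smul α)).congr (ae_of_all _ fun t => ?_)
  simp only
  rw [← sub_smul, smul_smul, blaschkeFactor, div_eq_mul_inv]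

theorem prod_blaschkeFactor_smul {f : UnitAddCircle → E} (hf : MemVectorHInf f) {N : ℕ}
    (α : Fin N → ℂ) (hα : ∀ m, ‖α m‖ < 1) (s : Finset (Fin N)) :
    MemVectorHInf fun t => (∏ m ∈ s, blaschkeFactor (α m) t) • f t := by
  classical
  induction s using Finset.induction_on with
  | empty => simpa using hf
  | insert m s hm ih =>
    simp only [Finset.prod_insert hm, mul_smul]
    exact ih.blaschkeFactor_smul (hα m)

end MemVectorHInf

theorem memLp_inv_sub_smul {f : UnitAddCircle → E} (hf : MemLp f ∞ haarAddCircle) {α : ℂ}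
    (hα : ‖α‖ < 1) : MemLp (fun t => ((toCircle t : ℂ) - α)⁻¹ • f t) ∞ haarAddCircle :=
  memLp_top_continuous_smul
    ((continuous_toCircle_coe.sub continuous_const).inv₀ (toCircle_sub_ne_zero hα)) hf

theorem fourierCoeff_eq_sub_of_inv_sub_smul {f : UnitAddCircle → E}
    (hf : MemLp f ∞ haarAddCircle) {α : ℂ} (hα : ‖α‖ < 1) (n : ℤ) :
    fourierCoeff f n = fourierCoeff (fun t => ((toCircle t : ℂ) - α)⁻¹ • f t) (n - 1) -
      α • fourierCoeff (fun t => ((toCircle t : ℂ) - α)⁻¹ • f t) n := by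
  have hL := memLp_inv_sub_smul hf hα
  set h : UnitAddCircle → E := fun t => ((toCircle t : ℂ) - α)⁻¹ • f t with hh
  have heq : f = fun t => (toCircle t : ℂ) • h t - (α • h) t := by
    ext t
    simp only [hh, Pi.smul_apply]
    rw [smul_smul, smul_smul, ← sub_smul, ← sub_mul, mul_inv_cancel₀ (toCircle_sub_ne_zero hα t),
      one_smul]
  rw [← fourierCoeff_toCircle_smul, ← fourierCoeff.const_smul, ← fourierCoeff_sub
    (integrable_of_memLp_top (memLp_top_continuous_smul continuous_toCircle_coe hL))
    (integrable_of_memLp_top (hL.const_smul α)), ← heq]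

variable [CompleteSpace E]

theorem memVectorHInf_const (c : E) : MemVectorHInf fun _ : UnitAddCircle => c :=
  ⟨memLp_const c, fun _ hn => fourierCoeff_const c hn.ne⟩

theorem MemVectorHInf.clm_apply {f : UnitAddCircle → E} (hf : MemVectorHInf f) (T : E →L[ℂ] E) :
    MemVectorHInf fun t => T (f t) := by
  refine ⟨T.comp_memLp' hf.1, fun n hn => ?_⟩
  have := T.integral_comp_comm ((integrable_of_memLp_top hf.1).fourier_smul (-n))
  simp only [map_smul] at this
  rw [fourierCoeff, this]
  exact (congrArg T (hf.2 n hn)).trans (map_zero T)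

/-- The coefficient of index `-1` of `c / (z - α) = c / z + c α / z ^ 2 + ⋯`. -/
theorem fourierCoeff_inv_sub_smul_const (c : E) {α : ℂ} (hα : ‖α‖ < 1) :
    fourierCoeff (fun t : UnitAddCircle => ((toCircle t : ℂ) - α)⁻¹ • c) (-1) = c := by
  have hrec := fourierCoeff_eq_sub_of_inv_sub_smul (memLp_const c) hα
  set h : UnitAddCircle → E := fun t => ((toCircle t : ℂ) - α)⁻¹ • c with hh
  -- Away from index `0` the recursion reads `h_{n-1} = α h_n`, so boundedness forces `h_0 = 0`.
  have h0 : fourierCoeff h 0 = 0 := by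
    refine eq_zero_of_forall_eq_pow_smul hα (y := fun k : ℕ => fourierCoeff h k)
      (fun k => norm_fourierCoeff_le h _) fun k => ?_
    induction k with
    | zero => simp
    | succ k ih =>
      have hk := hrec (k + 1)
      rw [fourierCoeff_const c (by omega), add_sub_cancel_right, eq_comm, sub_eq_zero] at hk
      rw [ih, hk, smul_smul, ← pow_succ]
      push_cast
      rfl
  have h1 := hrec 0
  rw [fourierCoeff_const_zero, h0, smul_zero, sub_zero, zero_sub] at h1
  exact h1.symm

/-- Division by a Blaschke factor: after subtracting the value `a` of `f` at `α`, the function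
`f - a` is divisible by `b_α` in `H^∞`. The value `a` is obtained as the coefficient of index `-1`
of `f / (z - α)`, since the coefficients of index `-1, -2, …` form a geometric sequence. -/
theorem exists_memVectorHInf_conj_blaschkeFactor_smul_sub {f : UnitAddCircle → E}
    (hf : MemVectorHInf f) {α : ℂ} (hα : ‖α‖ < 1) :
    ∃ a : E, MemVectorHInf fun t => conj (blaschkeFactor α t) • (f t - a) := by
  set a := fourierCoeff (fun t => ((toCircle t : ℂ) - α)⁻¹ • f t) (-1) with ha
  have hfa := hf.sub (memVectorHInf_const a)
  have hL := memLp_inv_sub_smul hfa.1 hα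
  have hrec := fourierCoeff_eq_sub_of_inv_sub_smul hfa.1 hα
  have h1 : fourierCoeff (fun t => ((toCircle t : ℂ) - α)⁻¹ • (f t - a)) (-1) = 0 := by
    simp only [smul_sub]
    rw [fourierCoeff_sub (integrable_of_memLp_top (memLp_inv_sub_smul hf.1 hα))
      (integrable_of_memLp_top (memLp_inv_sub_smul (memLp_const a) hα)),
      fourierCoeff_inv_sub_smul_const a hα, ← ha, sub_self]
  set h : UnitAddCircle → E := fun t => ((toCircle t : ℂ) - α)⁻¹ • (f t - a) with hh
  have hneg : ∀ k : ℕ, fourierCoeff h (-1 - k) = 0 := by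
    intro k
    induction k with
    | zero => simpa using h1
    | succ k ih =>
      have hk := hrec (-1 - k)
      rw [hfa.2 _ (by omega), ih, smul_zero, sub_zero] at hk
      rw [hk]
      congr 1
      push_cast
      ring
  have hH : MemVectorHInf h := ⟨hL, fun n hn => by
    have := hneg (-1 - n).toNat
    rwa [Int.toNat_of_nonneg (by omega), sub_sub_cancel] at this⟩
  refine ⟨a, (hH.sub (hH.toCircle_smul.const_smul (conj α))).congr (ae_of_all _ fun t => ?_)⟩
  simp only [hh]
  rw [conj_blaschkeFactor hα, div_eq_mul_inv, sub_mul, one_mul, sub_smul, smul_smul, smul_smul]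

end HardySpace

/-! ### Inner functions and Blaschke–Potapov factors -/

section InnerFunctions

variable {E : Type*} [NormedAddCommGroup E] [InnerProductSpace ℂ E]

theorem memHInf_iff {Φ : UnitAddCircle → E →L[ℂ] E} :
    MemHInf Φ ↔ ∀ x, MemVectorHInf fun t => Φ t x :=
  ⟨fun h x => ⟨h.1 x, fun n hn => h.2 n hn x⟩, fun h => ⟨fun x => (h x).1, fun n hn x =>
    (h x).2 n hn⟩⟩

theorem ae_norm_eq_of_ae_inner_eq {Φ : UnitAddCircle → E →L[ℂ] E} {x : E}
    (h : ∀ᵐ t ∂(haarAddCircle : Measure UnitAddCircle), ⟪Φ t x, Φ t x⟫_ℂ = ⟪x, x⟫_ℂ) :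
    ∀ᵐ t ∂(haarAddCircle : Measure UnitAddCircle), ‖Φ t x‖ = ‖x‖ := by
  filter_upwards [h] with t ht
  rw [norm_eq_sqrt_re_inner (𝕜 := ℂ), ht, ← norm_eq_sqrt_re_inner]

/-- The Fourier coefficients of an isometric family of operators are bounded operators. -/
theorem exists_clm_eq_fourierCoeff {Φ : UnitAddCircle → E →L[ℂ] E}
    (hΦm : ∀ x, MemLp (fun t => Φ t x) ∞ haarAddCircle)
    (hΦi : ∀ x, ∀ᵐ t ∂(haarAddCircle : Measure UnitAddCircle), ‖Φ t x‖ = ‖x‖) (n : ℤ) :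
    ∃ T : E →L[ℂ] E, ∀ x, T x = fourierCoeff (fun t => Φ t x) n := by
  let L : E →ₗ[ℂ] E :=
    { toFun := fun x => fourierCoeff (fun t => Φ t x) n
      map_add' := fun x y => by
        simp only [map_add]
        exact fourierCoeff_add_apply (hΦm x) (hΦm y) n
      map_smul' := fun c x => by
        simp only [map_smul]
        exact fourierCoeff.const_smul _ c n }
  refine ⟨L.mkContinuous 1 fun x => ?_, fun x => rfl⟩
  calc ‖L x‖ ≤ ∫ t, ‖Φ t x‖ ∂haarAddCircle := norm_fourierCoeff_le _ _
    _ = ∫ _, ‖x‖ ∂(haarAddCircle : Measure UnitAddCircle) := integral_congr_ae (hΦi x)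
    _ = 1 * ‖x‖ := by simp

variable [CompleteSpace E]

theorem IsInnerFun.ae_inner_eq {Δ : UnitAddCircle → E →L[ℂ] E} (hΔ : IsInnerFun Δ) (x y : E) :
    ∀ᵐ t ∂(haarAddCircle : Measure UnitAddCircle), ⟪Δ t x, Δ t y⟫_ℂ = ⟪x, y⟫_ℂ := by
  filter_upwards [hΔ.2 x y] with t ht
  rwa [ContinuousLinearMap.comp_apply, ContinuousLinearMap.adjoint_inner_left] at ht

theorem IsInnerFun.ae_norm_eq {Δ : UnitAddCircle → E →L[ℂ] E} (hΔ : IsInnerFun Δ) (x : E) :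
    ∀ᵐ t ∂(haarAddCircle : Measure UnitAddCircle), ‖Δ t x‖ = ‖x‖ :=
  ae_norm_eq_of_ae_inner_eq (hΔ.ae_inner_eq x x)

/-- An inner function `Δ` with `Δ A = ν I`, `A` analytic and `|ν| = 1`, is a constant unitary:
`A = ν Δ^*` has only nonnegative frequencies and `Δ^*` only nonpositive ones. -/
theorem IsInnerFun.exists_unitary_of_mul_eq_const {Δ A : UnitAddCircle → E →L[ℂ] E}
    (hΔ : IsInnerFun Δ) (hA : MemHInf A) {ν : ℂ} (hν : ‖ν‖ = 1)
    (h : ∀ x, ∀ᵐ t ∂(haarAddCircle : Measure UnitAddCircle), Δ t (A t x) = ν • x) :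
    ∃ V ∈ unitary (E →L[ℂ] E), ∀ x, ∀ᵐ t ∂(haarAddCircle : Measure UnitAddCircle),
      Δ t x = V x := by
  have hν0 : ν ≠ 0 := norm_ne_zero_iff.mp (by rw [hν]; exact one_ne_zero)
  have hΔi := fun x => integrable_of_memLp_top (hΔ.1.1 x)
  have hAi := fun x => integrable_of_memLp_top (hA.1 x)
  have hadj : ∀ x y, ∀ᵐ t ∂(haarAddCircle : Measure UnitAddCircle),
      ⟪y, A t x⟫_ℂ = ν * ⟪Δ t y, x⟫_ℂ := by
    intro x y
    filter_upwards [h x, ae_inner_clm_apply_eq hΔ.ae_inner_eq (hA.1 x).1 y] with t h1 h2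
    rw [← h2, h1, inner_smul_right]
  have hpos : ∀ n > 0, ∀ y, fourierCoeff (fun t => Δ t y) n = 0 := by
    intro n hn y
    refine ext_inner_left ℂ fun x => ?_
    have h1 : ⟪y, fourierCoeff (fun t => A t x) (-n)⟫_ℂ =
        ν * conj ⟪x, fourierCoeff (fun t => Δ t y) n⟫_ℂ := by
      rw [← fourierCoeff_inner (hAi x), ← fourierCoeff_inner (hΔi y),
        fourierCoeff_congr_ae (hadj x y), fourierCoeff.const_mul, fourierCoeff, fourierCoeff,
        ← integral_conj]
      simp only [smul_eq_mul, map_mul, ← fourier_neg, inner_conj_symm]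
    rw [hA.2 _ (by omega), inner_zero_right, eq_comm, mul_eq_zero, or_iff_right hν0,
      map_eq_zero] at h1
    rw [h1, inner_zero_right]
  obtain ⟨V, hV⟩ := exists_clm_eq_fourierCoeff hΔ.1.1 hΔ.ae_norm_eq 0
  have hVΔ : ∀ x, ∀ᵐ t ∂(haarAddCircle : Measure UnitAddCircle), Δ t x = V x := by
    intro x
    have hL : MemLp (fun t => Δ t x - V x) ∞ haarAddCircle := (hΔ.1.1 x).sub (memLp_const _)
    have h0 : (fun t => Δ t x - V x) =ᵐ[haarAddCircle] 0 := by
      refine ae_eq_zero_of_fourierCoeff_eq_zero (hL.mono_exponent le_top) fun n => ?_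
      rw [fourierCoeff_sub (hΔi x) (integrable_const _)]
      rcases lt_trichotomy n 0 with hn | rfl | hn
      · rw [hΔ.1.2 n hn, fourierCoeff_const _ hn.ne, sub_zero]
      · rw [fourierCoeff_const_zero, hV, sub_self]
      · rw [hpos n hn, fourierCoeff_const _ hn.ne', sub_zero]
    filter_upwards [h0] with t ht using sub_eq_zero.mp ht
  have hVinner : ∀ x y, ⟪V x, V y⟫_ℂ = ⟪x, y⟫_ℂ := by
    intro x y
    obtain ⟨t, h1, h2, h3⟩ := ((hVΔ x).and ((hVΔ y).and (hΔ.ae_inner_eq x y))).exists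
    rw [← h1, ← h2, h3]
  have hsurj : Function.Surjective V := by
    intro x
    have hax : ∀ᵐ t ∂(haarAddCircle : Measure UnitAddCircle),
        A t x = ν • ContinuousLinearMap.adjoint V x := by
      have h0 := ae_eq_zero_of_forall_ae_inner_eq_zero
        (f := fun t => A t x - ν • ContinuousLinearMap.adjoint V x)
        ((hAi x).sub (integrable_const _)) fun y => by
          filter_upwards [hadj x y, hVΔ y] with t h1 h2
          rw [inner_sub_right, h1, h2, inner_smul_right,
            ContinuousLinearMap.adjoint_inner_right, sub_self]
      filter_upwards [h0] with t ht using sub_eq_zero.mp ht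
    obtain ⟨t, h1, h2, h3⟩ :=
      (hax.and ((hVΔ (ν • ContinuousLinearMap.adjoint V x)).and (h x))).exists
    refine ⟨ContinuousLinearMap.adjoint V x, smul_right_injective E hν0 ?_⟩
    simp only
    rw [← map_smul, ← h2, ← h1, h3]
  have hVV : star V * V = 1 := by
    ext x
    refine ext_inner_left ℂ fun y => ?_
    rw [mul_apply_eq_comp, ContinuousLinearMap.star_eq_adjoint,
      ContinuousLinearMap.adjoint_inner_right, hVinner, one_apply_eq_self]
  refine ⟨V, Unitary.mem_iff.mpr ⟨hVV, ?_⟩, hVΔ⟩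
  ext x
  obtain ⟨y, rfl⟩ := hsurj x
  have : star V (V y) = y := congrArg (fun T : E →L[ℂ] E => T y) hVV
  rw [mul_apply_eq_comp, this, one_apply_eq_self]

/-- Splitting off one Blaschke–Potapov factor from an inner left divisor of `b_α θ I`: the
projection `P` is onto the closed subspace of those `x` for which `Δ x` is divisible by `b_α`,
that is, onto the kernel of the value of `Δ` at `α`. -/
theorem IsInnerFun.exists_factor {Δ A : UnitAddCircle → E →L[ℂ] E}
    (hΔ : IsInnerFun Δ) (hA : MemHInf A) {α : ℂ} (hα : ‖α‖ < 1) {θ : UnitAddCircle → ℂ}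
    (hθ : ∀ x : E, MemVectorHInf fun t => θ t • x)
    (h : ∀ x, ∀ᵐ t ∂(haarAddCircle : Measure UnitAddCircle),
      Δ t (A t x) = (θ t * blaschkeFactor α t) • x) :
    ∃ (P : E →L[ℂ] E) (Δ' A' : UnitAddCircle → E →L[ℂ] E), IsStarProjection P ∧
      IsInnerFun Δ' ∧ MemHInf A' ∧
      (∀ x, ∀ᵐ t ∂(haarAddCircle : Measure UnitAddCircle), Δ' t (A' t x) = θ t • x) ∧
      ∀ t, Δ t = Δ' t * blaschkePotapovFactor α P t := by
  have hΔH := memHInf_iff.mp hΔ.1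
  have hAH := memHInf_iff.mp hA
  set b : UnitAddCircle → ℂ := fun t => conj (blaschkeFactor α t) with hb
  have hbb : ∀ t, b t * blaschkeFactor α t = 1 := conj_mul_blaschkeFactor hα
  have hbb' : ∀ t, conj (b t) * b t = 1 := fun t => by
    rw [hb, Complex.conj_conj, mul_comm, conj_mul_blaschkeFactor hα]
  have hbc : Continuous b := continuous_conj_blaschkeFactor hα
  have hΦm : ∀ x, MemLp (fun t => (b t • Δ t) x) ∞ haarAddCircle := fun x =>
    memLp_top_continuous_smul hbc (hΔ.1.1 x)
  have hΦi : ∀ x, ∀ᵐ t ∂(haarAddCircle : Measure UnitAddCircle), ‖(b t • Δ t) x‖ = ‖x‖ := by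
    intro x
    filter_upwards [hΔ.ae_norm_eq x] with t ht
    rw [smul_apply, norm_smul, ht, hb, Complex.norm_conj,
      norm_blaschkeFactor hα, one_mul]
  choose T hT using exists_clm_eq_fourierCoeff hΦm hΦi
  let K : Submodule ℂ E := ⨅ n : {n : ℤ // n < 0}, LinearMap.ker (T n : E →ₗ[ℂ] E)
  have hK : ∀ x, x ∈ K ↔ MemVectorHInf fun t => b t • Δ t x := by
    intro x
    rw [Submodule.mem_iInf]
    constructor
    · exact fun hx => ⟨hΦm x, fun n hn => (hT n x).symm.trans (hx ⟨n, hn⟩)⟩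
    · exact fun hx n => (hT n x).trans (hx.2 n n.2)
  have hKc : IsClosed (K : Set E) := by
    rw [Submodule.coe_iInf]
    exact isClosed_iInter fun n => (T n).isClosed_ker
  have : CompleteSpace K := hKc.completeSpace_coe
  set P : E →L[ℂ] E := K.starProjection with hP
  have hPK : ∀ x, P x ∈ K := fun x => Submodule.starProjection_apply_mem _ _
  have hPP : ∀ x, P (P x) = P x := fun x => Submodule.starProjection_eq_self_iff.mpr (hPK x)
  have hPorth : ∀ x y, ⟪P x, y - P y⟫_ℂ = 0 := fun x y =>
    (Submodule.mem_orthogonal _ _).mp (Submodule.sub_starProjection_mem_orthogonal y) _ (hPK x)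
  have hPorth' : ∀ x y, ⟪x - P x, P y⟫_ℂ = 0 := fun x y =>
    (Submodule.mem_orthogonal' _ _).mp (Submodule.sub_starProjection_mem_orthogonal x) _ (hPK y)
  -- `A x - a` is divisible by `b_α` for some `a` (the value of `A x` at `α`), and `a ∈ K` because
  -- `Δ a = θ b_α x - Δ (A x - a)`.
  have hdiv : ∀ x, MemVectorHInf fun t => b t • (A t x - P (A t x)) := by
    intro x
    obtain ⟨a, ha⟩ := exists_memVectorHInf_conj_blaschkeFactor_smul_sub (hAH x) hα
    have hprod : MemVectorHInf fun t => Δ t (b t • (A t x - a)) := by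
      refine ⟨?_, fun n hn => fourierCoeff_clm_apply_eq_zero (fun x => (hΔ.1.1 x).1)
        hΔ.ae_norm_eq hΔ.1.2 (ha.1.mono_exponent le_top) ha.2 hn⟩
      exact (memLp_congr_norm (aestronglyMeasurable_clm_apply (fun x => (hΔ.1.1 x).1) ha.1.1)
        ha.1.1 (ae_norm_clm_apply_eq hΔ.ae_norm_eq ha.1.1)).mpr ha.1
    have haK : a ∈ K := by
      rw [hK]
      refine ((hθ x).sub hprod).congr ?_
      filter_upwards [h x] with t ht
      rw [map_smul, map_sub, ht, smul_sub, smul_smul, mul_left_comm, hbb, mul_one]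
      abel
    refine (ha.clm_apply (1 - P)).congr (ae_of_all _ fun t => ?_)
    have hPa : P a = a := Submodule.starProjection_eq_self_iff.mpr haK
    simp only [map_smul, sub_apply, one_apply_eq_self, map_sub, hPa]
    congr 1
    abel
  refine ⟨P, fun t => b t • (Δ t * P) + Δ t * (1 - P), fun t => P * A t + b t • ((1 - P) * A t),
    isStarProjection_starProjection, ⟨memHInf_iff.mpr fun x => ?_, fun x y => ?_⟩,
    memHInf_iff.mpr fun x => ?_, fun x => ?_, fun t => ?_⟩
  · refine (((hK _).mp (hPK x)).add (hΔH (x - P x))).congr (ae_of_all _ fun t => ?_)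
    simp
  · filter_upwards [hΔ.ae_inner_eq (P x) (P y), hΔ.ae_inner_eq (P x) (y - P y),
      hΔ.ae_inner_eq (x - P x) (P y), hΔ.ae_inner_eq (x - P x) (y - P y)] with t h1 h2 h3 h4
    rw [ContinuousLinearMap.comp_apply, ContinuousLinearMap.adjoint_inner_left]
    simp only [add_apply, smul_apply,
      mul_apply_eq_comp, sub_apply, one_apply_eq_self]
    rw [inner_add_left, inner_add_right, inner_add_right, inner_smul_left, inner_smul_left,
      inner_smul_right, inner_smul_right, h1, h2, h3, h4, hPorth, hPorth', ← mul_assoc, hbb']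
    calc _ = ⟪P x, P y⟫_ℂ + ⟪x - P x, y - P y⟫_ℂ := by ring
      _ = ⟪P x, y⟫_ℂ + ⟪x - P x, y⟫_ℂ := by
        have e1 := hPorth x y
        have e2 := hPorth' x y
        rw [inner_sub_right] at e1 ⊢
        rw [e2, ← sub_eq_zero.mp e1, sub_zero]
      _ = ⟪x, y⟫_ℂ := by rw [← inner_add_left, add_sub_cancel]
  · refine (((hAH x).clm_apply P).add (hdiv x)).congr (ae_of_all _ fun t => ?_)
    simp
  · filter_upwards [h x] with t ht
    have hval : θ t • x = b t • Δ t (A t x) := by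
      rw [ht, smul_smul, mul_left_comm, hbb, mul_one]
    simp only [add_apply, smul_apply,
      mul_apply_eq_comp, sub_apply, one_apply_eq_self,
      map_add, map_sub, map_smul, hPP]
    rw [hval]
    module
  · ext x
    have hbβ : ∀ v : E, blaschkeFactor α t • b t • v = v := fun v => by
      rw [smul_smul, mul_comm, hbb, one_smul]
    simp only [blaschkePotapovFactor, add_apply, smul_apply,
      mul_apply_eq_comp, sub_apply, one_apply_eq_self,
      map_add, map_sub, map_smul, hPP, smul_add, hbβ, smul_sub]
    abel

theorem IsInnerFun.isFiniteBlaschkePotapovProduct {N : ℕ} (α : Fin N → ℂ) (hα : ∀ m, ‖α m‖ < 1)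
    {ν : ℂ} (hν : ‖ν‖ = 1) {Δ A : UnitAddCircle → E →L[ℂ] E} (hΔ : IsInnerFun Δ) (hA : MemHInf A)
    (h : ∀ x, ∀ᵐ t ∂(haarAddCircle : Measure UnitAddCircle),
      Δ t (A t x) = (ν * ∏ m, blaschkeFactor (α m) t) • x) :
    IsFiniteBlaschkePotapovProduct Δ := by
  induction N generalizing Δ A with
  | zero =>
    obtain ⟨V, hV, hVΔ⟩ := hΔ.exists_unitary_of_mul_eq_const hA hν (by simpa using h)
    exact ⟨V, 0, α, fun _ => 0, hV, hα, fun m => m.elim0, by simpa [StrongAEEq] using hVΔ⟩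
  | succ N ih =>
    obtain ⟨P, Δ', A', hP, hΔ', hA', h', hfac⟩ := hΔ.exists_factor hA (hα (Fin.last N))
      (θ := fun t => ν * ∏ m : Fin N, blaschkeFactor (α m.castSucc) t)
      (fun x => by
        simp only [mul_smul]
        exact ((memVectorHInf_const x).prod_blaschkeFactor_smul _
          (fun m => hα m.castSucc) _).const_smul ν)
      (by simpa only [Fin.prod_univ_castSucc, mul_assoc] using h)
    obtain ⟨V, M, β, Q, hV, hβ, hQ, hprod⟩ := ih (fun m => α m.castSucc) (fun m => hα _) hΔ' hA' h'
    refine ⟨V, M + 1, Fin.snoc β (α (Fin.last N)), Fin.snoc Q P, hV, fun m => ?_, fun m => ?_,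
      fun x => ?_⟩
    · refine Fin.lastCases ?_ (fun i => ?_) m
      · simpa using hα (Fin.last N)
      · simpa using hβ i
    · refine Fin.lastCases ?_ (fun i => ?_) m
      · simpa using hP
      · simpa using hQ i
    · filter_upwards [hprod (P x), hprod (x - P x)] with t h1 h2
      simp only [List.ofFn_succ', Fin.snoc_castSucc, Fin.snoc_last, List.concat_eq_append,
        List.prod_append, List.prod_singleton, hfac, blaschkePotapovFactor,
        mul_apply_eq_comp, add_apply,
        smul_apply, sub_apply,
        one_apply_eq_self, map_add, map_smul] at h1 h2 ⊢
      rw [h1, h2]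

end InnerFunctions

theorem theorem3p5 {E : Type*} [NormedAddCommGroup E] [InnerProductSpace ℂ E] [CompleteSpace E]
    (θ : UnitAddCircle → ℂ) (hθ : IsFiniteBlaschkeProduct θ)
    (Δ : UnitAddCircle → (E →L[ℂ] E))
    (hΔ : IsInnerDivisor Δ (fun t => θ t • (1 : E →L[ℂ] E))) :
    IsFiniteBlaschkePotapovProduct Δ := by
  obtain ⟨ν, N, α, hν, hα, hθ⟩ := hθ
  obtain ⟨⟨hin, A, hA, hΔA⟩, -⟩ := hΔ
  refine hin.isFiniteBlaschkePotapovProduct α hα hν hA fun x => ?_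
  filter_upwards [hΔA x] with t ht
  rw [← hθ t]
  exact ht.symm
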